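/- Let $\alpha>1$ be a real number and let $\mathbb N=\{1,2,3,\dots\}$. For a sequence $(d_i)_{i\ge 1}$ in $\mathbb N$ put \[ \langle d_i\rangle_\alpha=\sum_{i=1}^{\infty}(\alpha-1)^{i-1}\alpha^{-(d_1+\dots+d_i)}, \] a convergent series; the $d_i$ are called the $\alpha$-digits of this number. For $D\subseteq\mathbb N$ let $I_\alpha(D)=\{\langle d_i\rangle_\alpha : d_i\in D \text{ for all } i\ge 1\}$. For every nonempty (finite or infinite) set $D\subseteq\mathbb N$, the equation \[ \sum_{i\in D}\Bigl(\frac{\alpha-1}{\alpha^{i}}\Bigr)^{h}=1 \] has exactly one real solution $h$ (a solution includes convergence of the series); it satisfies $h\ge 0$, and the Hausdorff dimension of $I_\alpha(D)$ is $\dim_H I_\alpha(D)=h$. Moreover, the set $\{\langle d_i\rangle_\alpha : (d_i)\text{ is a bounded sequence in }\mathbb N\}$ has Lebesgue measure zero and Hausdorff dimension one. -/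

import Mathlib

open MeasureTheory Set

noncomputable section

/-- The number `⟨d₁, d₂, …⟩_α = ∑_{i ≥ 1} (α - 1)^(i - 1) α^(-(d₁ + ⋯ + d_i))` with the sequence of
`α`-digits `d`. Digits are positive integers; the sequence is indexed from `0` here, so `d k` is
the digit `d_{k+1}`. -/
def alphaValue (α : ℝ) (d : ℕ → ℕ+) : ℝ :=
  ∑' k : ℕ, (α - 1) ^ k / α ^ (∑ j ∈ Finset.range (k + 1), (d j : ℕ))

/-- The series defining `alphaValue` converges, so that it has no junk value for `α > 1`. -/
theorem summable_alphaValue {α : ℝ} (hα : 1 < α) (d : ℕ → ℕ+) :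
    Summable fun k : ℕ => (α - 1) ^ k / α ^ (∑ j ∈ Finset.range (k + 1), (d j : ℕ)) := by
  have h0 : (0 : ℝ) < α := by linarith
  have h1 : (0 : ℝ) ≤ α - 1 := by linarith
  have hr : (α - 1) / α < 1 := by
    rw [div_lt_one h0]
    linarith
  refine Summable.of_nonneg_of_le (fun k => by positivity) (fun k => ?_)
    (summable_geometric_of_lt_one (by positivity) hr)
  rw [div_pow]
  have hk : k ≤ ∑ j ∈ Finset.range (k + 1), (d j : ℕ) := by
    calc k ≤ ∑ j ∈ Finset.range (k + 1), 1 := by simp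
      _ ≤ _ := Finset.sum_le_sum fun j _ => (d j).pos
  gcongr
  exact hα.le

/-- `I_α(D)`: the numbers all of whose `α`-digits lie in `D`. -/
def digitSet (α : ℝ) (D : Set ℕ+) : Set ℝ :=
  {x | ∃ d : ℕ → ℕ+, (∀ k, d k ∈ D) ∧ alphaValue α d = x}

/-- The numbers whose sequence of `α`-digits is bounded. -/
def boundedDigitSet (α : ℝ) : Set ℝ :=
  {x | ∃ d : ℕ → ℕ+, BddAbove (range d) ∧ alphaValue α d = x}

end

open Filter Topology
open scoped ENNReal NNReal

/-! `digitSet α D` is self-similar: the maps `x ↦ α⁻ⁱ + rᵢ x` with `rᵢ = (α - 1) α⁻ⁱ` send `[0, 1]`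
to intervals with disjoint interiors. Upper bound (`dimH_digitSet_le`): the `h`-th powers of the
diameters of the cylinders of order `n` sum to at most `(∑ rᵢ ^ h) ^ n = 1`. Lower bound: for `0 < s
< h` a finite `F ⊆ D` has `∑ rᵢ ^ s ≥ 1`. Subdividing `[0, 1)` repeatedly in proportions `rᵢ ^ s`
codes each point by digits in `F`; bounded digits give separated cylinders, so passing from values
back to points is `s`-Hölder (`le_dimH_digitSet_finset`). Since `∑ rᵢ = 1` over all digits, every
alphabet `{1, …, N}` has dimension below one, while finite alphabets approach dimension one. -/

/-- The contraction ratio of the similarity `x ↦ α⁻ⁱ + (α - 1) α⁻ⁱ x` that prepends the digit `i`. -/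
noncomputable def digitRatio (α : ℝ) (i : ℕ+) : ℝ := (α - 1) / α ^ (i : ℕ)

theorem digitRatio_pos {α : ℝ} (hα : 1 < α) (i : ℕ+) : 0 < digitRatio α i := by
  have : 0 < α := by linarith
  have : 0 < α - 1 := by linarith
  unfold digitRatio
  positivity

theorem digitRatio_anti {α : ℝ} (hα : 1 < α) {i j : ℕ+} (hij : i ≤ j) :
    digitRatio α j ≤ digitRatio α i := by
  have : 0 < α := by linarith
  have : 0 < α - 1 := by linarith
  have : (i : ℕ) ≤ j := hij
  unfold digitRatio
  gcongr
  exact hα.le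

theorem digitRatio_one_lt_one {α : ℝ} (hα : 1 < α) : digitRatio α 1 < 1 := by
  have : 0 < α := by linarith
  rw [digitRatio, PNat.one_coe, pow_one, div_lt_one this]
  linarith

theorem digitRatio_lt_one {α : ℝ} (hα : 1 < α) (i : ℕ+) : digitRatio α i < 1 :=
  (digitRatio_anti hα one_le).trans_lt (digitRatio_one_lt_one hα)

/-! ### Similarity structure of the values -/

theorem alphaValue_eq_cons {α : ℝ} (hα : 1 < α) (d : ℕ → ℕ+) :
    alphaValue α d = 1 / α ^ (d 0 : ℕ) + digitRatio α (d 0) * alphaValue α fun k => d (k + 1) := by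
  have h0 : α ≠ 0 := by linarith
  unfold alphaValue
  rw [(summable_alphaValue hα d).tsum_eq_zero_add, ← tsum_mul_left]
  refine congrArg₂ (· + ·) (by simp) (tsum_congr fun k => ?_)
  rw [Finset.sum_range_succ' (fun j => (d j : ℕ)) (k + 1), digitRatio, pow_add α, pow_succ (α - 1)]
  field_simp

theorem alphaValue_nonneg {α : ℝ} (hα : 1 < α) (d : ℕ → ℕ+) : 0 ≤ alphaValue α d := by
  have : 0 < α := by linarith
  have : 0 < α - 1 := by linarith
  exact tsum_nonneg fun k => by positivity

theorem one_div_pow_le_alphaValue {α : ℝ} (hα : 1 < α) (d : ℕ → ℕ+) :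
    1 / α ^ (d 0 : ℕ) ≤ alphaValue α d := by
  rw [alphaValue_eq_cons hα]
  have := mul_nonneg (digitRatio_pos hα (d 0)).le (alphaValue_nonneg hα fun k => d (k + 1))
  linarith

theorem alphaValue_le_one {α : ℝ} (hα : 1 < α) (d : ℕ → ℕ+) : alphaValue α d ≤ 1 := by
  have h0 : 0 < α := by linarith
  have h1 : 0 < α - 1 := by linarith
  have hr : (α - 1) / α < 1 := by
    rw [div_lt_one h0]
    linarith
  have hg := (hasSum_geometric_of_lt_one (by positivity) hr).mul_left (1 / α)
  have he : 1 / α * (1 - (α - 1) / α)⁻¹ = 1 := by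
    have : 1 - (α - 1) / α = 1 / α := by field_simp; ring
    rw [this]
    field_simp
  rw [← he, ← hg.tsum_eq]
  refine (summable_alphaValue hα d).tsum_le_tsum (fun k => ?_) hg.summable
  have hk : k + 1 ≤ ∑ j ∈ Finset.range (k + 1), (d j : ℕ) := by
    calc k + 1 = ∑ j ∈ Finset.range (k + 1), 1 := by simp
      _ ≤ _ := Finset.sum_le_sum fun j _ => (d j).pos
  calc (α - 1) ^ k / α ^ (∑ j ∈ Finset.range (k + 1), (d j : ℕ))
      ≤ (α - 1) ^ k / α ^ (k + 1) := by
        gcongr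
        exact hα.le
    _ = 1 / α * ((α - 1) / α) ^ k := by
        rw [div_pow, pow_succ]
        field_simp

theorem abs_alphaValue_sub_le {α : ℝ} (hα : 1 < α) (n : ℕ) (d e : ℕ → ℕ+)
    (h : ∀ k < n, d k = e k) :
    |alphaValue α d - alphaValue α e| ≤ ∏ k ∈ Finset.range n, digitRatio α (d k) := by
  induction n generalizing d e with
  | zero =>
    have := alphaValue_nonneg hα d
    have := alphaValue_nonneg hα e
    have := alphaValue_le_one hα d
    have := alphaValue_le_one hα e
    rw [Finset.prod_range_zero, abs_le]
    constructor <;> linarith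
  | succ n ih =>
    have hi := ih (fun k => d (k + 1)) (fun k => e (k + 1)) fun k hk => h (k + 1) (by omega)
    have hp := digitRatio_pos hα (d 0)
    rw [alphaValue_eq_cons hα d, alphaValue_eq_cons hα e, ← h 0 (by omega), add_sub_add_left_eq_sub,
      ← mul_sub, abs_mul, abs_of_pos hp, Finset.prod_range_succ', mul_comm]
    gcongr

/-- Values whose first digits differ are uniformly separated when the digits are bounded. -/
theorem alphaValue_separated {α : ℝ} (hα : 1 < α) {M : ℕ+} {d e : ℕ → ℕ+}
    (hd : ∀ k, d k ≤ M) (hne : d 0 < e 0) :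
    digitRatio α M * (1 / α ^ (M : ℕ)) ≤ alphaValue α d - alphaValue α e := by
  have h0 : 0 < α := by linarith
  have h1 : 0 < α - 1 := by linarith
  have hx : 1 / α ^ (M : ℕ) ≤ alphaValue α fun k => d (k + 1) := by
    refine le_trans ?_ (one_div_pow_le_alphaValue hα _)
    have : (d (0 + 1) : ℕ) ≤ M := hd 1
    gcongr
    exact hα.le
  have hprod : digitRatio α M * (1 / α ^ (M : ℕ)) ≤
      digitRatio α (d 0) * alphaValue α fun k => d (k + 1) := by
    have := digitRatio_pos hα (d 0)
    gcongr
    exact digitRatio_anti hα (hd 0)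
  -- The cylinder of `e 0` ends no later than that of `d 0` begins, so the gap is the contribution
  -- of the tail of `d`.
  have hy : alphaValue α e ≤ 1 / α ^ (d 0 : ℕ) := by
    have hlt : (d 0 : ℕ) + 1 ≤ e 0 := hne
    have hp := digitRatio_pos hα (e 0)
    calc alphaValue α e
        ≤ 1 / α ^ (e 0 : ℕ) + digitRatio α (e 0) * 1 := by
          rw [alphaValue_eq_cons hα e]
          gcongr
          exact alphaValue_le_one hα _
      _ = α / α ^ (e 0 : ℕ) := by
          rw [digitRatio]
          ring
      _ ≤ α / α ^ ((d 0 : ℕ) + 1) := by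
          gcongr
          exact hα.le
      _ = 1 / α ^ (d 0 : ℕ) := by
          rw [pow_succ]
          field_simp
  rw [alphaValue_eq_cons hα d]
  linarith

/-! ### Upper bound for the dimension -/

theorem ENNReal.tsum_pi_fin_prod {ι : Type*} (f : ι → ℝ≥0∞) (n : ℕ) :
    ∑' w : Fin n → ι, ∏ k, f (w k) = (∑' i, f i) ^ n := by
  induction n with
  | zero => simp
  | succ n ih =>
    rw [← (Fin.consEquiv fun _ : Fin (n + 1) => ι).tsum_eq, ENNReal.tsum_prod', pow_succ', ← ih,
      ← ENNReal.tsum_mul_right]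
    refine tsum_congr fun i => ?_
    rw [← ENNReal.tsum_mul_left]
    refine tsum_congr fun w => ?_
    simp [Fin.prod_univ_succ, Fin.consEquiv]

theorem dimH_digitSet_le {α : ℝ} (hα : 1 < α) {D : Set ℕ+} {h : ℝ} (h0 : 0 ≤ h)
    (hs : HasSum (fun i : D => digitRatio α i ^ h) 1) :
    dimH (digitSet α D) ≤ ENNReal.ofReal h := by
  -- Cylinders: only the first `n` digits are constrained.
  let c (n : ℕ) (w : Fin n → D) : Set ℝ :=
    {x | ∃ d : ℕ → ℕ+, (∀ k : Fin n, d k = w k) ∧ alphaValue α d = x}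
  have hdiam (n : ℕ) (w : Fin n → D) :
      Metric.ediam (c n w) ≤ ENNReal.ofReal (∏ k, digitRatio α (w k)) := by
    refine Metric.ediam_le_of_forall_dist_le ?_
    rintro _ ⟨d, hd, rfl⟩ _ ⟨e, he, rfl⟩
    rw [Real.dist_eq]
    refine (abs_alphaValue_sub_le hα n d e fun k hk => ?_).trans_eq ?_
    · rw [hd ⟨k, hk⟩, he ⟨k, hk⟩]
    · rw [Finset.prod_range]
      simp only [hd]
  have hsum : ∑' i : D, ENNReal.ofReal (digitRatio α i) ^ h = 1 := by
    rw [← ENNReal.ofReal_one, ← hs.tsum_eq, ENNReal.ofReal_tsum_of_nonneg _ hs.summable]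
    · exact tsum_congr fun i => ENNReal.ofReal_rpow_of_pos (digitRatio_pos hα i)
    · exact fun i => (Real.rpow_pos_of_pos (digitRatio_pos hα i) h).le
  have hle : μH[h] (digitSet α D) ≤ 1 := by
    refine (Measure.hausdorffMeasure_le_liminf_tsum (l := atTop) h _
      (fun n : ℕ => ENNReal.ofReal (digitRatio α 1 ^ n)) ?_ c (.of_forall fun n w => ?_)
      (.of_forall fun n => ?_)).trans ?_
    · rw [← ENNReal.ofReal_zero]
      exact ENNReal.tendsto_ofReal (tendsto_pow_atTop_nhds_zero_of_lt_one
        (digitRatio_pos hα 1).le (digitRatio_one_lt_one hα))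
    · refine (hdiam n w).trans (ENNReal.ofReal_le_ofReal ?_)
      calc ∏ k, digitRatio α (w k) ≤ ∏ _k : Fin n, digitRatio α 1 :=
            Finset.prod_le_prod (fun k _ => (digitRatio_pos hα _).le)
              fun k _ => digitRatio_anti hα one_le
        _ = digitRatio α 1 ^ n := by simp
    · rintro _ ⟨d, hd, rfl⟩
      exact mem_iUnion.2 ⟨fun k => ⟨d k, hd k⟩, d, fun _ => rfl, rfl⟩
    · have key (n : ℕ) : ∑' w, Metric.ediam (c n w) ^ h ≤ 1 := by
        calc ∑' w, Metric.ediam (c n w) ^ h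
            ≤ ∑' w : Fin n → D, ∏ k, ENNReal.ofReal (digitRatio α (w k)) ^ h := by
              refine ENNReal.tsum_le_tsum fun w => ?_
              rw [ENNReal.prod_rpow_of_nonneg h0,
                ← ENNReal.ofReal_prod_of_nonneg fun k _ => (digitRatio_pos hα _).le]
              exact ENNReal.rpow_le_rpow (hdiam n w) h0
          _ = 1 := by
              rw [ENNReal.tsum_pi_fin_prod fun i : D => ENNReal.ofReal (digitRatio α i) ^ h, hsum,
                one_pow]
      exact (liminf_le_liminf (.of_forall key)).trans_eq (liminf_const _)
  have := dimH_le_of_hausdorffMeasure_ne_top (d := h.toNNReal) (s := digitSet α D)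
    (by rw [Real.coe_toNNReal _ h0]; exact (hle.trans_lt ENNReal.one_lt_top).ne)
  exact this

/-! ### Lower bound for the dimension -/

/-- Consecutive half-open intervals of lengths `p i` cover `[0, ∑ p i)`. -/
theorem exists_mem_Ico_partition {ι : Type*} (s : Finset ι) (p : ι → ℝ) :
    ∃ P : ι → ℝ, ∀ t, 0 ≤ t → t < ∑ i ∈ s, p i → ∃ i ∈ s, P i ≤ t ∧ t < P i + p i := by
  classical
  induction s using Finset.induction with
  | empty => exact ⟨0, fun t h h' => absurd h (by simpa using h')⟩
  | insert a s ha ih =>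
    obtain ⟨P, hP⟩ := ih
    -- The new interval is attached at the right end of the old ones.
    refine ⟨Function.update P a (∑ i ∈ s, p i), fun t h h' => ?_⟩
    rw [Finset.sum_insert ha] at h'
    rcases lt_or_ge t (∑ i ∈ s, p i) with hlt | hge
    · obtain ⟨i, hi, h1, h2⟩ := hP t h hlt
      have hia : i ≠ a := fun e => ha (e ▸ hi)
      exact ⟨i, Finset.mem_insert_of_mem hi, by simp [hia, h1, h2]⟩
    · exact ⟨a, Finset.mem_insert_self _ _, by simpa using hge, by simp; linarith⟩

/-- A set that is the image of `[0, 1)` under an `s`-anti-Hölder map has dimension at least `s`. -/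
theorem le_dimH_of_antiHolder {f : ℝ → ℝ} {S : Set ℝ} {s C : ℝ} (hs : 0 < s)
    (hf : ∀ t ∈ Ico (0 : ℝ) 1, f t ∈ S)
    (h : ∀ t ∈ Ico (0 : ℝ) 1, ∀ u ∈ Ico (0 : ℝ) 1, |t - u| ≤ C * |f t - f u| ^ s) :
    ENNReal.ofReal s ≤ dimH S := by
  have hinj : InjOn f (Ico 0 1) := fun t ht u hu e => by
    have := h t ht u hu
    rw [e, sub_self, abs_zero, Real.zero_rpow hs.ne', mul_zero] at this
    exact sub_eq_zero.1 (abs_nonpos_iff.1 this)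
  have hinv : LeftInvOn (Function.invFunOn f (Ico 0 1)) f (Ico 0 1) := hinj.leftInvOn_invFunOn
  have hold : HolderOnWith C.toNNReal s.toNNReal (Function.invFunOn f (Ico 0 1))
      (f '' Ico 0 1) := by
    rintro _ ⟨t, ht, rfl⟩ _ ⟨u, hu, rfl⟩
    rw [hinv ht, hinv hu, edist_dist, edist_dist, Real.dist_eq, Real.dist_eq,
      Real.coe_toNNReal _ hs.le, ENNReal.ofReal_rpow_of_nonneg (abs_nonneg _) hs.le]
    change _ ≤ ENNReal.ofReal C * _
    rw [← ENNReal.ofReal_mul' (by positivity)]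
    exact ENNReal.ofReal_le_ofReal (h t ht u hu)
  have hdim := hold.dimH_image_le (Real.toNNReal_pos.2 hs)
  have hIco : dimH (Ico (0 : ℝ) 1) = 1 := by
    rw [Real.dimH_of_nonempty_interior (by simp)]
    simp
  rw [hinv.image_image, hIco] at hdim
  have hmono : dimH (f '' Ico 0 1) ≤ dimH S := dimH_mono (image_subset_iff.2 hf)
  have h1 := (ENNReal.le_div_iff_mul_le (by simp [hs]) (by simp)).1 hdim
  rw [one_mul] at h1
  exact h1.trans hmono

theorem le_dimH_digitSet_finset {α : ℝ} (hα : 1 < α) {F : Finset ℕ+} {s : ℝ} (hs : 0 < s)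
    (hF : 1 ≤ ∑ i ∈ F, digitRatio α i ^ s) :
    ENNReal.ofReal s ≤ dimH (digitSet α (F : Set ℕ+)) := by
  obtain ⟨P, hP⟩ := exists_mem_Ico_partition F fun i => digitRatio α i ^ s
  -- `i` is the first digit of `t` and `u` its rescaled position in the chosen interval; the values
  -- off `[0, 1)` are never used.
  have hex (t : ℝ) : ∃ i : ℕ+, ∃ u : ℝ, t ∈ Ico (0 : ℝ) 1 →
      i ∈ F ∧ u ∈ Ico (0 : ℝ) 1 ∧ t = P i + digitRatio α i ^ s * u := by
    by_cases ht : t ∈ Ico (0 : ℝ) 1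
    · obtain ⟨i, hi, h1, h2⟩ := hP t ht.1 (ht.2.trans_le hF)
      have hp := Real.rpow_pos_of_pos (digitRatio_pos hα i) s
      refine ⟨i, (t - P i) / digitRatio α i ^ s, fun _ => ⟨hi, ⟨?_, ?_⟩, ?_⟩⟩
      · exact div_nonneg (by linarith) hp.le
      · rw [div_lt_one hp]
        linarith
      · field_simp
        ring
    · exact ⟨1, 0, fun h => absurd h ht⟩
  choose δ T hT using hex
  let code (t : ℝ) (k : ℕ) : ℕ+ := δ (T^[k] t)
  have hiter (t : ℝ) (ht : t ∈ Ico (0 : ℝ) 1) (k : ℕ) : T^[k] t ∈ Ico (0 : ℝ) 1 := by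
    induction k with
    | zero => exact ht
    | succ k ih =>
      rw [Function.iterate_succ_apply']
      exact (hT _ ih).2.1
  have hcode (t : ℝ) (ht : t ∈ Ico (0 : ℝ) 1) (k : ℕ) : code t k ∈ F := (hT _ (hiter t ht k)).1
  let M : ℕ+ := F.sup id ⊔ 1
  have hM (t : ℝ) (ht : t ∈ Ico (0 : ℝ) 1) (k : ℕ) : code t k ≤ M :=
    (Finset.le_sup (f := id) (hcode t ht k)).trans le_sup_left
  have h0 : 0 < α := by linarith
  have hc : 0 < digitRatio α M * (1 / α ^ (M : ℕ)) := mul_pos (digitRatio_pos hα M) (by positivity)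
  set c := digitRatio α M * (1 / α ^ (M : ℕ))
  have hsep (t u : ℝ) (ht : t ∈ Ico (0 : ℝ) 1) (hu : u ∈ Ico (0 : ℝ) 1) (hne : δ t ≠ δ u) :
      c ≤ |alphaValue α (code t) - alphaValue α (code u)| := by
    rcases lt_or_gt_of_ne hne with hlt | hlt
    · exact (alphaValue_separated hα (hM t ht) (e := code u) hlt).trans (le_abs_self _)
    · rw [abs_sub_comm]
      exact (alphaValue_separated hα (hM u hu) (e := code t) hlt).trans (le_abs_self _)
  set ρ := digitRatio α 1 ^ s
  have hρ1 : ρ < 1 := Real.rpow_lt_one (digitRatio_pos hα 1).le (digitRatio_one_lt_one hα) hs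
  have hρ0 : 0 < ρ := Real.rpow_pos_of_pos (digitRatio_pos hα 1) s
  -- Each shared digit expands the distance by at least `ρ⁻¹`, so points more than `ρ ^ n` apart
  -- share fewer than `n` leading digits.
  have main (n : ℕ) : ∀ t ∈ Ico (0 : ℝ) 1, ∀ u ∈ Ico (0 : ℝ) 1, ρ ^ n < |t - u| →
      |t - u| ≤ (c ^ s)⁻¹ * |alphaValue α (code t) - alphaValue α (code u)| ^ s := by
    induction n with
    | zero =>
      intro t ht u hu hlt
      have : |t - u| ≤ 1 := abs_le.2 ⟨by linarith [ht.1, hu.2], by linarith [ht.2, hu.1]⟩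
      rw [pow_zero] at hlt
      linarith
    | succ n ih =>
      intro t ht u hu hlt
      have hcs := Real.rpow_pos_of_pos hc s
      -- With equal first digits both sides scale by `rᵢ ^ s`, so the constant does not grow; with
      -- distinct ones `hsep` suffices.
      by_cases hne : δ t = δ u
      · have hr := digitRatio_pos hα (δ t)
        have hrs := Real.rpow_pos_of_pos hr s
        have htu : |t - u| = digitRatio α (δ t) ^ s * |T t - T u| := by
          conv_lhs => rw [(hT t ht).2.2, (hT u hu).2.2, ← hne, add_sub_add_left_eq_sub, ← mul_sub,
            abs_mul, abs_of_pos hrs]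
        have hval : |alphaValue α (code t) - alphaValue α (code u)| =
            digitRatio α (δ t) * |alphaValue α (code (T t)) - alphaValue α (code (T u))| := by
          rw [alphaValue_eq_cons hα (code t), alphaValue_eq_cons hα (code u)]
          change |_ + digitRatio α (δ t) * alphaValue α (code (T t)) -
            (1 / α ^ (δ u : ℕ) + digitRatio α (δ u) * alphaValue α (code (T u)))| = _
          rw [← hne]
          change |1 / α ^ (δ t : ℕ) + _ - _| = _
          rw [add_sub_add_left_eq_sub, ← mul_sub, abs_mul, abs_of_pos hr]
        have hle : digitRatio α (δ t) ^ s ≤ ρ :=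
          Real.rpow_le_rpow hr.le (digitRatio_anti hα one_le) hs.le
        have hlt' : ρ ^ n < |T t - T u| := by
          have : ρ * ρ ^ n < ρ * |T t - T u| := by
            rw [← pow_succ']
            refine hlt.trans_le (htu.trans_le ?_)
            gcongr
          exact lt_of_mul_lt_mul_left this hρ0.le
        have := ih _ (hT t ht).2.1 _ (hT u hu).2.1 hlt'
        rw [htu, hval, Real.mul_rpow hr.le (abs_nonneg _), mul_left_comm]
        gcongr
      · have : |t - u| ≤ 1 := abs_le.2 ⟨by linarith [ht.1, hu.2], by linarith [ht.2, hu.1]⟩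
        refine this.trans ?_
        rw [inv_mul_eq_div, one_le_div hcs]
        exact Real.rpow_le_rpow hc.le (hsep t u ht hu hne) hs.le
  refine le_dimH_of_antiHolder (f := fun t => alphaValue α (code t)) (C := (c ^ s)⁻¹) hs
    (fun t ht => ⟨code t, hcode t ht, rfl⟩) fun t ht u hu => ?_
  rcases eq_or_ne t u with rfl | hne
  · simp [Real.zero_rpow hs.ne']
  · obtain ⟨n, hn⟩ := exists_pow_lt_of_lt_one (abs_pos.2 (sub_ne_zero.2 hne)) hρ1
    exact main n t ht u hu hn

/-- If `∑_{i ∈ D} r_i ^ h = 1`, then for `0 < s < h` finitely many digits from `D` already produce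
a set of dimension at least `s`. -/
theorem exists_finset_le_dimH_digitSet {α : ℝ} (hα : 1 < α) {D : Set ℕ+} {h s : ℝ}
    (hsum : HasSum (fun i : D => digitRatio α i ^ h) 1) (hs : 0 < s) (hsh : s < h) :
    ∃ F : Finset ℕ+, (F : Set ℕ+) ⊆ D ∧
      ENNReal.ofReal s ≤ dimH (digitSet α (F : Set ℕ+)) := by
  classical
  have hr := digitRatio_pos hα 1
  -- This threshold pays for lowering the exponent: `rᵢ ^ h ≤ r₁ ^ (h - s) * rᵢ ^ s`.
  have hlt : digitRatio α 1 ^ (h - s) < 1 :=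
    Real.rpow_lt_one hr.le (digitRatio_one_lt_one hα) (by linarith)
  obtain ⟨G, hG⟩ := (hsum.eventually (lt_mem_nhds hlt)).exists
  refine ⟨G.map (Function.Embedding.subtype _), by simp, le_dimH_digitSet_finset hα hs ?_⟩
  rw [Finset.sum_map]
  have hpos : 0 < digitRatio α 1 ^ (h - s) := Real.rpow_pos_of_pos hr _
  refine le_of_mul_le_mul_left ?_ hpos
  rw [mul_one, Finset.mul_sum]
  refine hG.le.trans (Finset.sum_le_sum fun i _ => ?_)
  have hri := digitRatio_pos hα i
  calc digitRatio α i ^ h = digitRatio α i ^ (h - s) * digitRatio α i ^ s := by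
        rw [← Real.rpow_add hri, sub_add_cancel]
    _ ≤ digitRatio α 1 ^ (h - s) * digitRatio α i ^ s := by
        gcongr
        exact digitRatio_anti hα one_le

theorem digitSet_mono {α : ℝ} {D E : Set ℕ+} (h : D ⊆ E) : digitSet α D ⊆ digitSet α E := by
  rintro _ ⟨d, hd, rfl⟩
  exact ⟨d, fun k => h (hd k), rfl⟩

theorem dimH_digitSet {α : ℝ} (hα : 1 < α) {D : Set ℕ+} {h : ℝ} (h0 : 0 ≤ h)
    (hsum : HasSum (fun i : D => digitRatio α i ^ h) 1) :
    dimH (digitSet α D) = ENNReal.ofReal h := by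
  refine le_antisymm (dimH_digitSet_le hα h0 hsum) (le_of_forall_lt fun c hc => ?_)
  obtain ⟨s, hcs, hsh⟩ := ENNReal.lt_iff_exists_nnreal_btwn.1 hc
  have hs : 0 < (s : ℝ) := by
    have : 0 < (s : ℝ≥0∞) := zero_le.trans_lt hcs
    exact_mod_cast this
  have hsh' : (s : ℝ) < h := by
    rw [← ENNReal.ofReal_coe_nnreal] at hsh
    exact (ENNReal.ofReal_lt_ofReal_iff_of_nonneg hs.le).1 hsh
  obtain ⟨F, hFD, hF⟩ := exists_finset_le_dimH_digitSet hα hsum hs hsh'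
  rw [ENNReal.ofReal_coe_nnreal] at hF
  exact hcs.trans_le (hF.trans (dimH_mono (digitSet_mono hFD)))

/-! ### The dimension equation -/

theorem hasSum_digitRatio {α : ℝ} (hα : 1 < α) : HasSum (digitRatio α) 1 := by
  have h0 : 0 < α := by linarith
  have hα1 : α - 1 ≠ 0 := by linarith
  have hg := (hasSum_geometric_of_lt_one (inv_nonneg.2 h0.le) (inv_lt_one_of_one_lt₀ hα)).mul_left
    ((α - 1) / α)
  have he : (α - 1) / α * (1 - α⁻¹)⁻¹ = 1 := by
    have : 1 - α⁻¹ = (α - 1) / α := by field_simp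
    rw [this]
    field_simp
  rw [he] at hg
  rw [← Equiv.pnatEquivNat.symm.hasSum_iff]
  refine (funext fun k => ?_ : digitRatio α ∘ Equiv.pnatEquivNat.symm = _) ▸ hg
  simp only [Function.comp_apply, digitRatio, Equiv.pnatEquivNat_symm_apply, Nat.succPNat_coe,
    Nat.succ_eq_add_one, pow_succ, inv_pow]
  field_simp

theorem summable_digitRatio_rpow {α : ℝ} (hα : 1 < α) {s : ℝ} (hs : 0 < s) :
    Summable fun i : ℕ+ => digitRatio α i ^ s := by
  have h0 : 0 < α := by linarith
  have hα1 : 0 < α - 1 := by linarith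
  have hq : (α⁻¹) ^ s < 1 :=
    Real.rpow_lt_one (inv_nonneg.2 h0.le) (inv_lt_one_of_one_lt₀ hα) hs
  have hg := ((summable_geometric_of_lt_one (by positivity) hq).mul_left
    ((α - 1) ^ s)).comp_injective PNat.coe_injective
  refine hg.congr fun i => ?_
  rw [digitRatio, div_eq_mul_inv, Real.mul_rpow hα1.le (by positivity), ← inv_pow,
    ← Real.rpow_natCast, ← Real.rpow_mul (by positivity), mul_comm (_ : ℝ) s,
    Real.rpow_mul (by positivity), Real.rpow_natCast]
  rfl

theorem hasSum_digitRatio_rpow_unique {α : ℝ} (hα : 1 < α) {D : Set ℕ+} (hD : D.Nonempty) {s t : ℝ}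
    (hs : HasSum (fun i : D => digitRatio α i ^ s) 1)
    (ht : HasSum (fun i : D => digitRatio α i ^ t) 1) : s = t := by
  obtain ⟨a, ha⟩ := hD
  have aux {s t : ℝ} (hs : HasSum (fun i : D => digitRatio α i ^ s) 1)
      (ht : HasSum (fun i : D => digitRatio α i ^ t) 1) : ¬ s < t := fun hlt => by
    have hterm (i : D) : digitRatio α i ^ t < digitRatio α i ^ s :=
      Real.rpow_lt_rpow_of_exponent_gt (digitRatio_pos hα i) (digitRatio_lt_one hα i) hlt
    exact lt_irrefl (1 : ℝ) (hasSum_lt (fun i => (hterm i).le) (hterm ⟨a, ha⟩) ht hs)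
  exact le_antisymm (not_lt.1 (aux ht hs)) (not_lt.1 (aux hs ht))

/-- Intermediate values on `[ε, 1]`. The exponent `0` is avoided because the series diverges there
for infinite `D`; two digits already give the sum `2` at `0`, hence more than `1` at a small `ε`. -/
theorem exists_hasSum_digitRatio_rpow {α : ℝ} (hα : 1 < α) {D : Set ℕ+} (hD : D.Nonempty) :
    ∃ h : ℝ, 0 ≤ h ∧ HasSum (fun i : D => digitRatio α i ^ h) 1 := by
  rcases D.subsingleton_or_nontrivial with hsub | ⟨a, ha, b, hb, hab⟩
  · obtain ⟨a, ha⟩ := hD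
    obtain rfl := hsub.eq_singleton_of_mem ha
    exact ⟨0, le_rfl, by simp⟩
  have hsumm {s : ℝ} (hs : 0 < s) : Summable fun i : D => digitRatio α i ^ s :=
    (summable_digitRatio_rpow hα hs).subtype D
  obtain ⟨ε, hε0, hε1, hε⟩ : ∃ ε : ℝ, 0 < ε ∧ ε < 1 ∧
      1 < digitRatio α a ^ ε + digitRatio α b ^ ε := by
    have hcont : Continuous fun s : ℝ => digitRatio α a ^ s + digitRatio α b ^ s :=
      (Real.continuous_const_rpow (digitRatio_pos hα a).ne').add
        (Real.continuous_const_rpow (digitRatio_pos hα b).ne')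
    have hev : ∀ᶠ s in 𝓝[>] (0 : ℝ), 1 < digitRatio α a ^ s + digitRatio α b ^ s :=
      (hcont.continuousAt.eventually (lt_mem_nhds (by simp))).filter_mono nhdsWithin_le_nhds
    obtain ⟨ε, h1, h2, h3⟩ := (hev.and (Ioo_mem_nhdsGT (zero_lt_one' ℝ))).exists
    exact ⟨ε, h2, h3, h1⟩
  have hcont : ContinuousOn (fun s : ℝ => ∑' i : D, digitRatio α i ^ s) (Icc ε 1) := by
    refine continuousOn_tsum
      (fun i => (Real.continuous_const_rpow (digitRatio_pos hα i).ne').continuousOn)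
      (hsumm hε0) fun i s hs => ?_
    rw [Real.norm_of_nonneg (Real.rpow_pos_of_pos (digitRatio_pos hα i) s).le]
    exact Real.rpow_le_rpow_of_exponent_ge (digitRatio_pos hα i) (digitRatio_lt_one hα i).le hs.1
  have hleft : 1 ≤ ∑' i : D, digitRatio α i ^ ε := by
    have hne : (⟨a, ha⟩ : D) ≠ ⟨b, hb⟩ := by simpa using hab
    have := (hsumm hε0).sum_le_tsum ({⟨a, ha⟩, ⟨b, hb⟩} : Finset D)
      fun i _ => (Real.rpow_pos_of_pos (digitRatio_pos hα i) ε).le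
    rw [Finset.sum_pair hne] at this
    exact hε.le.trans this
  have hright : ∑' i : D, digitRatio α i ^ (1 : ℝ) ≤ 1 := by
    simp only [Real.rpow_one]
    rw [← (hasSum_digitRatio hα).tsum_eq]
    exact (hasSum_digitRatio hα).summable.tsum_subtype_le _ D fun i => (digitRatio_pos hα i).le
  obtain ⟨h, hmem, heq⟩ := intermediate_value_Icc' hε1.le hcont ⟨hright, hleft⟩
  have hpos : 0 < h := hε0.trans_le hmem.1
  exact ⟨h, hpos.le, heq ▸ (hsumm hpos).hasSum⟩

/-! ### Bounded digit sequences -/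

theorem volume_digitSet_Iic {α : ℝ} (hα : 1 < α) (N : ℕ+) : volume (digitSet α (Iic N)) = 0 := by
  obtain ⟨h, h0, hsum⟩ := exists_hasSum_digitRatio_rpow hα (D := Iic N) ⟨N, self_mem_Iic⟩
  -- The omitted digit `N + 1` makes the sum at exponent `1` strictly less than `1`.
  have hlt : h < 1 := by
    by_contra! hge
    have hle : (1 : ℝ) ≤ ∑' i : Iic N, digitRatio α i := by
      rw [← hsum.tsum_eq]
      refine hsum.summable.tsum_le_tsum (fun i => ?_) ((hasSum_digitRatio hα).summable.subtype _)
      exact (Real.rpow_le_rpow_of_exponent_ge (digitRatio_pos hα i) (digitRatio_lt_one hα i).le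
        hge).trans_eq (Real.rpow_one _)
    have hadd := (hasSum_digitRatio hα).summable.tsum_subtype_add_tsum_subtype_compl (Iic N)
    rw [(hasSum_digitRatio hα).tsum_eq] at hadd
    have hpos : 0 < ∑' i : ↥(Iic N)ᶜ, digitRatio α i :=
      ((hasSum_digitRatio hα).summable.subtype _).tsum_pos (fun i => (digitRatio_pos hα i).le)
        ⟨N + 1, by simp⟩ (digitRatio_pos hα _)
    linarith
  have hdim : dimH (digitSet α (Iic N)) < ((1 : ℝ≥0) : ℝ≥0∞) := by
    rw [dimH_digitSet hα h0 hsum]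
    simpa using hlt
  have := hausdorffMeasure_of_dimH_lt hdim
  rwa [NNReal.coe_one, hausdorffMeasure_real] at this

theorem boundedDigitSet_eq_iUnion (α : ℝ) :
    boundedDigitSet α = ⋃ N : ℕ+, digitSet α (Iic N) := by
  ext x
  simp only [boundedDigitSet, digitSet, mem_ofPred_eq, mem_iUnion, mem_Iic]
  constructor
  · rintro ⟨d, ⟨N, hN⟩, rfl⟩
    exact ⟨N, d, fun k => hN ⟨k, rfl⟩, rfl⟩
  · rintro ⟨N, d, hd, rfl⟩
    exact ⟨d, ⟨N, by rintro _ ⟨k, rfl⟩; exact hd k⟩, rfl⟩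

theorem volume_boundedDigitSet {α : ℝ} (hα : 1 < α) : volume (boundedDigitSet α) = 0 := by
  rw [boundedDigitSet_eq_iUnion, measure_iUnion_null_iff]
  exact volume_digitSet_Iic hα

theorem dimH_boundedDigitSet {α : ℝ} (hα : 1 < α) : dimH (boundedDigitSet α) = 1 := by
  refine le_antisymm ((dimH_mono (subset_univ _)).trans_eq Real.dimH_univ)
    (le_of_forall_lt fun c hc => ?_)
  obtain ⟨s, hcs, hs1⟩ := ENNReal.lt_iff_exists_nnreal_btwn.1 hc
  have hs : 0 < (s : ℝ) := by
    have : 0 < (s : ℝ≥0∞) := zero_le.trans_lt hcs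
    exact_mod_cast this
  have hs1' : (s : ℝ) < 1 := by exact_mod_cast hs1
  -- The full alphabet solves the equation with `h = 1`.
  have hsum : HasSum (fun i : (univ : Set ℕ+) => digitRatio α i ^ (1 : ℝ)) 1 := by
    simp only [Real.rpow_one]
    exact (Equiv.Set.univ ℕ+).hasSum_iff.2 (hasSum_digitRatio hα)
  obtain ⟨F, -, hF⟩ := exists_finset_le_dimH_digitSet hα hsum hs hs1'
  rw [ENNReal.ofReal_coe_nnreal] at hF
  refine hcs.trans_le (hF.trans (dimH_mono ?_))
  rintro _ ⟨d, hd, rfl⟩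
  exact ⟨d, F.bddAbove.mono (range_subset_iff.2 hd), rfl⟩

theorem theorem4p1 (α : ℝ) (hα : 1 < α) :
    (∀ D : Set ℕ+, D.Nonempty →
      ∃ h : ℝ, 0 ≤ h ∧
        HasSum (fun i : D => ((α - 1) / α ^ ((i : ℕ+) : ℕ)) ^ h) 1 ∧
        (∀ s : ℝ, HasSum (fun i : D => ((α - 1) / α ^ ((i : ℕ+) : ℕ)) ^ s) 1 → s = h) ∧
        dimH (digitSet α D) = ENNReal.ofReal h) ∧
    volume (boundedDigitSet α) = 0 ∧
    dimH (boundedDigitSet α) = 1 := by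
  refine ⟨fun D hD => ?_, volume_boundedDigitSet hα, dimH_boundedDigitSet hα⟩
  obtain ⟨h, h0, hsum⟩ := exists_hasSum_digitRatio_rpow hα hD
  exact ⟨h, h0, hsum, fun s hs => hasSum_digitRatio_rpow_unique hα hD hs hsum,
    dimH_digitSet hα h0 hsum⟩
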